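/- For a topological groupoid $\mathcal{G}$ write $\mathcal{G}^{(0)} \subseteq \mathcal{G}$ for its unit space and $s, r : \mathcal{G} \to \mathcal{G}^{(0)}$ for its source and range maps. $\mathcal{G}$ is principal if $s(g) = r(g)$ holds only for units $g$, and étale if $s$ and $r$ are local homeomorphisms. The dynamic asymptotic dimension $\mathrm{dad}(\mathcal{G})$ of a locally compact, Hausdorff, étale groupoid $\mathcal{G}$ is the smallest $d \in \mathbb{N} = \{0,1,2,\dots\}$ with the following property, and $\infty$ if there is no such $d$: for every open relatively compact $K \subseteq \mathcal{G}$ there are open sets $U_0, \dots, U_d \subseteq \mathcal{G}^{(0)}$ covering $s(K) \cup r(K)$ such that, for each $i \in \{0,\dots,d\}$, the set $\{g \in K : s(g), r(g) \in U_i\}$ is contained in a relatively compact subgroupoid of $\mathcal{G}$. For a sequence $(\mathcal{G}_i)_{i \in \mathbb{N}}$ of étale groupoids, let $$\prod_{i\in\mathbb{N}} (\mathcal{G}_i, \mathcal{G}_i^{(0)}) = \Big\{ (\gamma_i)_{i} \in \prod_{i\in\mathbb{N}} \mathcal{G}_i : \gamma_i \in \mathcal{G}_i^{(0)} \text{ for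 all but finitely many } i \Big\}$$ with component-wise operations and the restricted product topology, which has as a basis the sets $\prod_i V_i$ with $V_i \subseteq \mathcal{G}_i$ open for all $i$ and $V_i = \mathcal{G}_i^{(0)}$ for all but finitely many $i$. **Corollary.** Let $(\mathcal{G}_i)_{i \in \mathbb{N}}$ be a sequence of principal, second-countable, locally compact, Hausdorff, étale groupoids, each with a zero-dimensional, compact unit space. Suppose that $\mathrm{dad}(\mathcal{G}_i) \geq 1$ for all $i \in \mathbb{N}$. Then $$\mathrm{dad}\Big(\prod_{i\in\mathbb{N}} (\mathcal{G}_i, \mathcal{G}_i^{(0)})\Big) = \infty.$$ -/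

import Mathlib

open Filter
open scoped RestrictedProduct

/-- A groupoid, presented by its set `G` of arrows: units are identified with identity arrows,
`src` and `rng` are the source and range maps, and `comp g h` is the product `g h`, defined exactly
when `src g = rng h`. -/
class ArrowGroupoid (G : Type*) where
  src : G → G
  rng : G → G
  inv : G → G
  comp : ∀ g h : G, src g = rng h → G
  src_src : ∀ g, src (src g) = src g
  rng_src : ∀ g, rng (src g) = src g
  src_rng : ∀ g, src (rng g) = rng g
  rng_rng : ∀ g, rng (rng g) = rng g
  src_comp : ∀ g h (e : src g = rng h), src (comp g h e) = src h
  rng_comp : ∀ g h (e : src g = rng h), rng (comp g h e) = rng g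
  src_inv : ∀ g, src (inv g) = rng g
  rng_inv : ∀ g, rng (inv g) = src g
  comp_src : ∀ g, comp g (src g) (rng_src g).symm = g
  rng_comp_self : ∀ g, comp (rng g) g (src_rng g) = g
  comp_assoc : ∀ g h k (e : src g = rng h) (e' : src h = rng k),
    comp (comp g h e) k ((src_comp g h e).trans e') =
      comp g (comp h k e') (e.trans (rng_comp h k e').symm)
  comp_inv : ∀ g, comp g (inv g) (rng_inv g).symm = rng g
  inv_comp : ∀ g, comp (inv g) g (src_inv g) = src g

namespace ArrowGroupoid

/-- The unit space of `G`, as a subset of `G`; it carries the subspace topology. -/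
def units (G : Type*) [ArrowGroupoid G] : Set G := {u | src u = u}

section Maps

variable {G : Type*} [ArrowGroupoid G]

/-- The source map as a map from `G` to its unit space. -/
def srcMap (g : G) : units G := ⟨src g, src_src g⟩

/-- The range map as a map from `G` to its unit space. -/
def rngMap (g : G) : units G := ⟨rng g, src_rng g⟩

end Maps

/-- `G` is principal: every arrow from a unit to itself is that unit. -/
def IsPrincipal (G : Type*) [ArrowGroupoid G] : Prop :=
  ∀ u ∈ units G, ∀ g : G, src g = u → rng g = u → g = u

/-- A topological groupoid: inversion is continuous, and so is multiplication on the set of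
composable pairs (hence also source and range). -/
class IsTopologicalGroupoid (G : Type*) [TopologicalSpace G] [ArrowGroupoid G] : Prop where
  continuous_inv : Continuous (inv : G → G)
  continuous_comp : Continuous fun p : {p : G × G // src p.1 = rng p.2} =>
    comp p.1.1 p.1.2 p.2

/-- `G` is étale: range and source are local homeomorphisms to the unit space. -/
def IsEtale (G : Type*) [TopologicalSpace G] [ArrowGroupoid G] : Prop :=
  IsLocalHomeomorph (srcMap : G → units G) ∧ IsLocalHomeomorph (rngMap : G → units G)

/-- Subgroupoids: subsets closed under products and inverses (hence under source and range). -/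
structure IsSubgroupoid {G : Type*} [ArrowGroupoid G] (H : Set G) : Prop where
  inv_mem : ∀ g ∈ H, inv g ∈ H
  comp_mem : ∀ g ∈ H, ∀ h ∈ H, ∀ e : src g = rng h, comp g h e ∈ H

/-- A subset is relatively compact if its closure is compact. -/
def IsRelativelyCompact {X : Type*} [TopologicalSpace X] (K : Set X) : Prop :=
  IsCompact (closure K)

/-- The property whose least witness `d` is the dynamic asymptotic dimension: for every open
relatively compact `K ⊆ G` there are open sets `U 0, …, U d` of units covering `s(K) ∪ r(K)` such
that each `{g ∈ K | s(g), r(g) ∈ U i}` lies in a relatively compact subgroupoid. -/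
def HasDadProperty (G : Type*) [TopologicalSpace G] [ArrowGroupoid G] (d : ℕ) : Prop :=
  ∀ K : Set G, IsOpen K → IsRelativelyCompact K →
    ∃ U : Fin (d + 1) → Set (units G), (∀ i, IsOpen (U i)) ∧
      (srcMap '' K ∪ rngMap '' K ⊆ ⋃ i, U i) ∧
      ∀ i, ∃ H : Set G, IsSubgroupoid H ∧ IsRelativelyCompact H ∧
        {g | g ∈ K ∧ srcMap g ∈ U i ∧ rngMap g ∈ U i} ⊆ H

/-- The dynamic asymptotic dimension: the smallest natural number `d` with the property above,
and `⊤` if there is none. -/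
noncomputable def dad (G : Type*) [TopologicalSpace G] [ArrowGroupoid G] : ℕ∞ :=
  ⨅ (d : ℕ) (_ : HasDadProperty G d), (d : ℕ∞)

/-- The infinite product groupoid `∏ (G i, G i ^ (0))`: families of arrows almost all of which are
units. It carries Mathlib's restricted product topology. When the unit spaces are open (as in étale
groupoids), a basis is given by the sets `∏ V i` with `V i` open in `G i` for all `i` and
`V i = units (G i)` for almost all `i`. -/
abbrev InfiniteProduct {ι : Type*} (G : ι → Type*) [∀ i, ArrowGroupoid (G i)] :=
  Πʳ i, [G i, units (G i)]

/-- The componentwise groupoid structure on the infinite product. -/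
instance {ι : Type*} (G : ι → Type*) [∀ i, ArrowGroupoid (G i)] :
    ArrowGroupoid (InfiniteProduct G) where
  src x := ⟨fun i => src (x i), Eventually.of_forall fun i => src_src (x i)⟩
  rng x := ⟨fun i => rng (x i), Eventually.of_forall fun i => src_rng (x i)⟩
  inv x := ⟨fun i => inv (x i), x.2.mono fun i (hi : src (x i) = x i) => by
    have hr : rng (x i) = x i := by rw [← hi, rng_src]
    have hc := rng_comp_self (inv (x i))
    have h2 : inv (x i) = x i := by
      have h3 := comp_inv (x i)
      simp only [rng_inv, hi] at hc
      rw [← hc, h3, hr]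
    change src (inv (x i)) = inv (x i)
    rw [h2, hi]⟩
  comp x y e := ⟨fun i => comp (x i) (y i) (congrArg (fun z : InfiniteProduct G => z i) e), by
    filter_upwards [x.2, y.2] with i (hx : src (x i) = x i) (hy : src (y i) = y i)
    have e' : src (x i) = rng (y i) := congrArg (fun z : InfiniteProduct G => z i) e
    have hr : rng (y i) = y i := by rw [← hy, rng_src]
    have hxy : x i = y i := by rw [← hx, e', hr]
    have key : ∀ (a b : G i) (h : src a = rng b), a = b → src b = b → comp a b h = b := by
      rintro a _ h rfl hb
      have := comp_src a
      simpa only [hb] using this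
    have hk := key (x i) (y i) e' hxy hy
    change src (comp (x i) (y i) e') = comp (x i) (y i) e'
    rw [hk, hy]⟩
  src_src x := RestrictedProduct.ext _ _ fun i => src_src (x i)
  rng_src x := RestrictedProduct.ext _ _ fun i => rng_src (x i)
  src_rng x := RestrictedProduct.ext _ _ fun i => src_rng (x i)
  rng_rng x := RestrictedProduct.ext _ _ fun i => rng_rng (x i)
  src_comp x y _ := RestrictedProduct.ext _ _ fun i => src_comp (x i) (y i) _
  rng_comp x y _ := RestrictedProduct.ext _ _ fun i => rng_comp (x i) (y i) _
  src_inv x := RestrictedProduct.ext _ _ fun i => src_inv (x i)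
  rng_inv x := RestrictedProduct.ext _ _ fun i => rng_inv (x i)
  comp_src x := RestrictedProduct.ext _ _ fun i => comp_src (x i)
  rng_comp_self x := RestrictedProduct.ext _ _ fun i => rng_comp_self (x i)
  comp_assoc x y z e e' := RestrictedProduct.ext _ _ fun i => comp_assoc (x i) (y i) (z i)
    (congrArg (fun w : InfiniteProduct G => w i) e)
    (congrArg (fun w : InfiniteProduct G => w i) e')
  comp_inv x := RestrictedProduct.ext _ _ fun i => comp_inv (x i)
  inv_comp x := RestrictedProduct.ext _ _ fun i => inv_comp (x i)

end ArrowGroupoid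

/-! Suppose the product has the covering property for some `d`. In each factor, failure of dimension
zero gives a relatively compact `L` containing the units, with arbitrarily long non-repeating paths
whose steps lie in `L`; otherwise the powers of `L` would stabilise in a relatively compact
subgroupoid (`IsEtale.exists_arrows`). Paths of length `n` in the factors `0, …, d` multiply to a
grid `[0, n] ^ (d + 1)` in one orbit of the product, neighbouring grid points being joined by arrows
of one fixed relatively compact open box. The `d + 1` covering sets colour the grid, and the Hex
theorem (`exists_colour_chain`) yields a chain of some colour `k` crossing it in direction `k`. The
arrows along this chain lie in a single relatively compact subgroupoid, whose projection to factor
`k` thus contains `n + 1` arrows with a common source. Compact subsets of an étale groupoid meet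
source fibres in boundedly many points (`IsEtale.exists_card_fiber_le`), with a bound independent of
`n`: a contradiction for large `n`.

The Hex theorem follows from `IsInwardLabelling.exists_complementary`, a parity argument in the
style of Sperner. One counts pairs of a simplex and a facet carrying all positive labels. Without
complementary neighbours, such facets come in pairs within each simplex, so the count is even;
passing to the simplex across the facet pairs off all of them except `cornerDoor`, so it is odd. -/

/-! ### Alcoves of the Freudenthal triangulation and their flips. -/

/-- The steps between consecutive vertices of an alcove: the standard basis vectors, and the
vector with all entries `-1`. -/
def alcoveStep {D : ℕ} (k : Fin (D + 1)) (j : Fin D) : ℤ :=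
  (if k = j.castSucc then 1 else 0) - (if k = Fin.last D then 1 else 0)

/-- The cyclically ordered vertices of a simplex of the Freudenthal triangulation of `ℤ ^ D`. -/
def IsAlcove {D : ℕ} (v : Fin (D + 1) → Fin D → ℤ) : Prop :=
  ∃ p : Equiv.Perm (Fin (D + 1)), ∀ i, v (i + 1) = v i + alcoveStep (p i)

theorem alcoveStep_injective {D : ℕ} : Function.Injective (alcoveStep (D := D)) := by
  intro a b h
  have key : ∀ j : Fin D, ∀ b : Fin (D + 1),
      alcoveStep (D := D) j.castSucc = alcoveStep b → j.castSucc = b := by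
    intro j b h
    have := congrFun h j
    have h1 : j.castSucc ≠ Fin.last D := (Fin.castSucc_lt_last j).ne
    simp only [alcoveStep, h1, if_true, if_false] at this
    by_contra hne
    have h2 : b ≠ j.castSucc := fun h => hne h.symm
    simp only [h2, if_false] at this
    split_ifs at this <;> omega
  induction a using Fin.lastCases with
  | last =>
    induction b using Fin.lastCases with
    | last => rfl
    | cast j => exact (key j _ h.symm).symm
  | cast j => exact key j _ h

/-- Going round the alcove, coordinate `k` changes only twice: up at the step `e k`, down at the all
`-1` step. Questions about one coordinate thus reduce to the order of these two positions. -/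
theorem alcove_apply {D : ℕ} {v : Fin (D + 1) → Fin D → ℤ} {p : Equiv.Perm (Fin (D + 1))}
    (hp : ∀ i, v (i + 1) = v i + alcoveStep (p i)) (i : Fin (D + 1)) (k : Fin D) :
    v i k = v 0 k + (if p.symm k.castSucc < i then 1 else 0) -
      (if p.symm (Fin.last D) < i then 1 else 0) := by
  induction i using Fin.induction with
  | zero => simp
  | succ i ih =>
    rw [← Fin.coeSucc_eq_succ, hp, Pi.add_apply, ih, Fin.coeSucc_eq_succ]
    have h : ∀ a : Fin (D + 1), ((if p.symm a < i.succ then 1 else 0 : ℤ)) =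
        (if p.symm a < i.castSucc then 1 else 0) + (if p i.castSucc = a then 1 else 0) := by
      intro a
      have h1 : p i.castSucc = a ↔ p.symm a = i.castSucc :=
        ⟨fun h => by rw [← h]; simp, fun h => by rw [← h]; simp⟩
      simp only [h1, Fin.lt_def, Fin.ext_iff, Fin.val_succ, Fin.val_castSucc]
      split_ifs <;> omega
    rw [h, h]
    simp only [alcoveStep]
    ring

theorem IsAlcove.abs_sub_le {D : ℕ} {v : Fin (D + 1) → Fin D → ℤ} (hv : IsAlcove v)
    (i j : Fin (D + 1)) (k : Fin D) : |v i k - v j k| ≤ 1 := by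
  obtain ⟨p, hp⟩ := hv
  rw [alcove_apply hp i k, alcove_apply hp j k, abs_le]
  simp only [Fin.lt_def]
  split_ifs <;> omega

theorem IsAlcove.rotate {D : ℕ} {v : Fin (D + 1) → Fin D → ℤ} (hv : IsAlcove v)
    (j : Fin (D + 1)) : IsAlcove fun i => v (i + j) := by
  obtain ⟨p, hp⟩ := hv
  refine ⟨(Equiv.addRight j).trans p, fun i => ?_⟩
  have := hp (i + j)
  simp only [Equiv.trans_apply, Equiv.coe_addRight]
  rw [← this, add_right_comm]

theorem IsAlcove.rotate_ne {D : ℕ} {v : Fin (D + 1) → Fin D → ℤ} (hv : IsAlcove v)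
    {j : Fin (D + 1)} (hj : j ≠ 0) : (fun i => v (i + j)) ≠ v := by
  obtain ⟨p, hp⟩ := hv
  intro h
  have h0 : v (0 + j) = v 0 := congrFun h 0
  have h1 : v (0 + 1 + j) = v (0 + 1) := congrFun h (0 + 1)
  rw [add_right_comm, hp, hp, h0] at h1
  have := p.injective (alcoveStep_injective (add_left_cancel h1))
  exact hj (by simpa using this)

/-- The neighbour of an alcove across the facet opposite to its vertex `0`. -/
def alcoveFlip {D : ℕ} (v : Fin (D + 1) → Fin D → ℤ) : Fin (D + 1) → Fin D → ℤ :=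
  Function.update v 0 (v (Fin.last D) + v 1 - v 0)

theorem alcoveFlip_apply_of_ne {D : ℕ} (v : Fin (D + 1) → Fin D → ℤ) {i : Fin (D + 1)}
    (hi : i ≠ 0) : alcoveFlip v i = v i := by
  simp [alcoveFlip, hi]

theorem alcoveFlip_zero {D : ℕ} (v : Fin (D + 1) → Fin D → ℤ) :
    alcoveFlip v 0 = v (Fin.last D) + v 1 - v 0 := by
  simp [alcoveFlip]

theorem Fin.one_ne_zero_of_neZero {D : ℕ} [NeZero D] : (1 : Fin (D + 1)) ≠ 0 := by
  obtain ⟨d, rfl⟩ := Nat.exists_eq_succ_of_ne_zero (NeZero.ne D)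
  exact one_ne_zero

theorem Fin.last_ne_zero_of_neZero {D : ℕ} [NeZero D] : Fin.last D ≠ 0 := by
  intro h
  exact NeZero.ne D (by simpa using congrArg Fin.val h)

theorem alcoveFlip_alcoveFlip {D : ℕ} [NeZero D] (v : Fin (D + 1) → Fin D → ℤ) :
    alcoveFlip (alcoveFlip v) = v := by
  funext i
  by_cases hi : i = 0
  · subst hi
    rw [alcoveFlip_zero, alcoveFlip_zero, alcoveFlip_apply_of_ne _ Fin.one_ne_zero_of_neZero,
      alcoveFlip_apply_of_ne _ Fin.last_ne_zero_of_neZero]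
    abel
  · rw [alcoveFlip_apply_of_ne _ hi, alcoveFlip_apply_of_ne _ hi]

theorem IsAlcove.flip {D : ℕ} [NeZero D] {v : Fin (D + 1) → Fin D → ℤ} (hv : IsAlcove v) :
    IsAlcove (alcoveFlip v) := by
  obtain ⟨p, hp⟩ := hv
  have h10 := Fin.one_ne_zero_of_neZero (D := D)
  have hl0 := Fin.last_ne_zero_of_neZero (D := D)
  have h0 := hp 0
  have hl := hp (Fin.last D)
  rw [zero_add] at h0
  rw [Fin.last_add_one] at hl
  -- Replacing vertex `0` exchanges the step that enters it with the step that leaves it.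
  refine ⟨(Equiv.swap 0 (Fin.last D)).trans p, fun i => ?_⟩
  by_cases hi : i = 0
  · subst hi
    rw [zero_add, alcoveFlip_apply_of_ne _ h10, alcoveFlip_zero, Equiv.trans_apply,
      Equiv.swap_apply_left, ← sub_eq_iff_eq_add'.2 hl]
    abel
  by_cases hi' : i = Fin.last D
  · subst hi'
    rw [Fin.last_add_one, alcoveFlip_apply_of_ne _ hl0, alcoveFlip_zero, Equiv.trans_apply,
      Equiv.swap_apply_right, h0]
    abel
  · have h : i + 1 ≠ 0 := by
      intro h
      exact hi' (add_right_cancel (h.trans (Fin.last_add_one D).symm))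
    rw [alcoveFlip_apply_of_ne _ h, alcoveFlip_apply_of_ne _ hi, Equiv.trans_apply,
      Equiv.swap_apply_of_ne_of_ne hi hi', hp]

theorem IsAlcove.flip_ne {D : ℕ} [NeZero D] {v : Fin (D + 1) → Fin D → ℤ} (hv : IsAlcove v) :
    alcoveFlip v ≠ v := by
  obtain ⟨p, hp⟩ := hv
  intro h
  have h := congrFun h 0
  have h0 := hp 0
  have hl := hp (Fin.last D)
  rw [zero_add] at h0
  rw [Fin.last_add_one] at hl
  rw [alcoveFlip_zero, h0, hl, ← sub_eq_zero] at h
  have h2 : alcoveStep (p 0) = alcoveStep (p (Fin.last D)) := by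
    rw [← sub_eq_zero, ← h]
    abel
  exact Fin.last_ne_zero_of_neZero (p.injective (alcoveStep_injective h2)).symm

/-- If an alcove lies in the slab `a ≤ x k ≤ b` and its flip does not, then the common facet lies
in the boundary of the slab. -/
theorem alcoveFlip_lt {D : ℕ} [NeZero D] {v : Fin (D + 1) → Fin D → ℤ}
    {p : Equiv.Perm (Fin (D + 1))} (hp : ∀ i, v (i + 1) = v i + alcoveStep (p i))
    {k : Fin D} {a : ℤ} (ha : ∀ i, a ≤ v i k) (h : alcoveFlip v 0 k < a) :
    p.symm (Fin.last D) = 0 ∧ ∀ i ≠ 0, v i k = a := by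
  have hf := alcove_apply hp
  have hne : p.symm k.castSucc ≠ p.symm (Fin.last D) := fun h =>
    (Fin.castSucc_lt_last k).ne (p.symm.injective h)
  have hD := NeZero.pos D
  have hone : ((1 : Fin (D + 1)) : ℕ) = 1 := by
    rw [Fin.val_one', Nat.mod_eq_of_lt (by omega)]
  rw [alcoveFlip_zero, Pi.sub_apply, Pi.add_apply] at h
  have e1 := hf 1 k
  have e2 := hf (Fin.last D) k
  have a0 := ha 0
  have a1 := ha 1
  have a2 := ha (Fin.last D)
  set x := p.symm k.castSucc with hx
  set y := p.symm (Fin.last D) with hy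
  simp only [Fin.lt_def, Fin.val_last, hone] at e1 e2
  have hxy : (x : ℕ) ≠ y := fun h => hne (Fin.ext h)
  have hxl := x.is_le
  have hyl := y.is_le
  -- If the all `-1` step came later, either the flip would stay in the slab or the vertex right
  -- after that step would already lie below `a`.
  have hy0 : (y : ℕ) = 0 := by
    by_contra hy0
    by_cases hyD : (y : ℕ) = D
    · split_ifs at e1 e2 <;> omega
    · have e3 := hf ⟨y + 1, by omega⟩ k
      have a3 := ha ⟨y + 1, by omega⟩
      simp only [Fin.lt_def, ← hx] at e3
      split_ifs at e1 e2 e3 <;> omega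
  refine ⟨Fin.ext hy0, fun i hi => ?_⟩
  have hi : (i : ℕ) ≠ 0 := fun h => hi (Fin.ext h)
  have e3 := hf i k
  simp only [Fin.lt_def, ← hx] at e3
  have := i.is_le
  split_ifs at e1 e2 e3 <;> omega

/-- Mirror image of `alcoveFlip_lt`: here the step `e k` must be the one leaving vertex `0`. -/
theorem lt_alcoveFlip {D : ℕ} [NeZero D] {v : Fin (D + 1) → Fin D → ℤ} (hv : IsAlcove v)
    {k : Fin D} {b : ℤ} (hb : ∀ i, v i k ≤ b) (h : b < alcoveFlip v 0 k) :
    ∀ i ≠ 0, v i k = b := by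
  obtain ⟨p, hp⟩ := hv
  have hf := alcove_apply hp
  have hne : p.symm k.castSucc ≠ p.symm (Fin.last D) := fun h =>
    (Fin.castSucc_lt_last k).ne (p.symm.injective h)
  have hD := NeZero.pos D
  have hone : ((1 : Fin (D + 1)) : ℕ) = 1 := by
    rw [Fin.val_one', Nat.mod_eq_of_lt (by omega)]
  rw [alcoveFlip_zero, Pi.sub_apply, Pi.add_apply] at h
  have e1 := hf 1 k
  have e2 := hf (Fin.last D) k
  have a0 := hb 0
  have a1 := hb 1
  have a2 := hb (Fin.last D)
  set x := p.symm k.castSucc with hx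
  set y := p.symm (Fin.last D) with hy
  simp only [Fin.lt_def, Fin.val_last, hone] at e1 e2
  have hxy : (x : ℕ) ≠ y := fun h => hne (Fin.ext h)
  have hxl := x.is_le
  have hyl := y.is_le
  have hx0 : (x : ℕ) = 0 := by
    by_contra hx0
    by_cases hxD : (x : ℕ) = D
    · split_ifs at e1 e2 <;> omega
    · have e3 := hf ⟨x + 1, by omega⟩ k
      have a3 := hb ⟨x + 1, by omega⟩
      simp only [Fin.lt_def, ← hx] at e3
      split_ifs at e1 e2 e3 <;> omega
  intro i hi
  have hi : (i : ℕ) ≠ 0 := fun h => hi (Fin.ext h)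
  have e3 := hf i k
  simp only [Fin.lt_def, ← hx] at e3
  have := i.is_le
  split_ifs at e1 e2 e3 <;> omega

/-! ### Doors and the parity argument. -/

/-- The vertices of `v` other than `v 0` carry all the positive labels. -/
def IsDoor {D : ℕ} (L : (Fin D → ℤ) → Fin D × Bool) (v : Fin (D + 1) → Fin D → ℤ) : Prop :=
  ∀ k, ∃ i, i ≠ 0 ∧ L (v i) = (k, true)

/-- There are as many vertices in the facet as positive labels, so each label occurs exactly once.
-/
theorem IsDoor.exists_perm {D : ℕ} {L : (Fin D → ℤ) → Fin D × Bool}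
    {v : Fin (D + 1) → Fin D → ℤ} (hv : IsDoor L v) :
    ∃ e : Equiv.Perm (Fin D), ∀ k, L (v (e k).succ) = (k, true) := by
  have h : ∀ k, ∃ i : Fin D, L (v i.succ) = (k, true) := by
    intro k
    obtain ⟨i, hi, h⟩ := hv k
    obtain ⟨j, rfl⟩ := Fin.exists_succ_eq.2 hi
    exact ⟨j, h⟩
  choose f hf using h
  have hinj : Function.Injective f := by
    intro a b hab
    have := (hf a).symm.trans (hab ▸ hf b)
    exact congrArg Prod.fst this
  exact ⟨Equiv.ofBijective f (Finite.injective_iff_bijective.1 hinj), hf⟩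

theorem IsDoor.snd_eq_true {D : ℕ} {L : (Fin D → ℤ) → Fin D × Bool}
    {v : Fin (D + 1) → Fin D → ℤ} (hv : IsDoor L v) {i : Fin (D + 1)} (hi : i ≠ 0) :
    (L (v i)).2 = true := by
  obtain ⟨e, he⟩ := hv.exists_perm
  obtain ⟨j, rfl⟩ := Fin.exists_succ_eq.2 hi
  have := he (e.symm j)
  rw [e.apply_symm_apply] at this
  rw [this]

theorem IsDoor.eq_of_label_eq {D : ℕ} {L : (Fin D → ℤ) → Fin D × Bool}
    {v : Fin (D + 1) → Fin D → ℤ} (hv : IsDoor L v) {i j : Fin (D + 1)} (hi : i ≠ 0)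
    (hj : j ≠ 0) (h : L (v i) = L (v j)) : i = j := by
  obtain ⟨e, he⟩ := hv.exists_perm
  obtain ⟨i, rfl⟩ := Fin.exists_succ_eq.2 hi
  obtain ⟨j, rfl⟩ := Fin.exists_succ_eq.2 hj
  have h1 := he (e.symm i)
  have h2 := he (e.symm j)
  rw [e.apply_symm_apply] at h1 h2
  rw [h1, h2] at h
  rw [e.symm.injective (congrArg Prod.fst h)]

/-- The old vertex `0` replaces vertex `j` in the facet and has the same label. This leads from one
door of an alcove to its other one. -/
theorem IsDoor.rotate {D : ℕ} {L : (Fin D → ℤ) → Fin D × Bool}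
    {v : Fin (D + 1) → Fin D → ℤ} (hv : IsDoor L v) {j : Fin (D + 1)} (hj : j ≠ 0)
    (h : L (v j) = L (v 0)) : IsDoor L fun i => v (i + j) := by
  intro k
  obtain ⟨i, hi, hk⟩ := hv k
  by_cases hij : i = j
  · subst hij
    exact ⟨-i, neg_ne_zero.2 hi, by simpa [← h] using hk⟩
  · exact ⟨i - j, sub_ne_zero.2 hij, by simpa using hk⟩

/-- A point has a first coordinate, if any, outside of `[0, n]`. -/
theorem exists_first_outside {D : ℕ} {n : ℤ} {x : Fin D → ℤ} {k : Fin D}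
    (h : ¬ (0 ≤ x k ∧ x k ≤ n)) :
    ∃ l ≤ k, ¬ (0 ≤ x l ∧ x l ≤ n) ∧ ∀ m < l, 0 ≤ x m ∧ x m ≤ n := by
  induction k using WellFoundedLT.induction with
  | ind k ih =>
    by_cases hk : ∀ m < k, 0 ≤ x m ∧ x m ≤ n
    · exact ⟨k, le_rfl, h, hk⟩
    · push Not at hk
      obtain ⟨m, hm, hm'⟩ := hk
      obtain ⟨l, hl, hl'⟩ := ih m hm (fun h => (hm' h.1).not_ge h.2)
      exact ⟨l, hl.trans hm.le, hl'⟩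

/-- The labels `(k, true)` and `(k, false)` of points of `[-1, n + 1] ^ D` stand for the vectors
`e k` and `-e k`; near the boundary they point inwards in the first possible direction. -/
structure IsInwardLabelling {D : ℕ} (n : ℤ) (L : (Fin D → ℤ) → Fin D × Bool) : Prop where
  lower : ∀ x k, x k = -1 → (∀ l < k, 0 ≤ x l ∧ x l ≤ n) → L x = (k, true)
  upper : ∀ x k, x k = n + 1 → (∀ l < k, 0 ≤ x l ∧ x l ≤ n) → L x = (k, false)

/-- The unique door in the boundary of the box `[-1, n + 1] ^ D`. -/
def cornerDoor (D : ℕ) (i : Fin (D + 1)) (k : Fin D) : ℤ :=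
  (if k.succ < i then 1 else 0) - (if 0 < i then 1 else 0)

theorem isAlcove_cornerDoor (D : ℕ) : IsAlcove (cornerDoor D) := by
  refine ⟨Equiv.subRight 1, fun i => ?_⟩
  funext k
  have hk := k.2
  induction i using Fin.lastCases with
  | last =>
    rw [Fin.last_add_one]
    simp only [cornerDoor, Pi.add_apply, alcoveStep, Equiv.subRight_apply]
    have h1 : Fin.last D - 1 = k.castSucc ↔ k.succ = Fin.last D := by
      rw [sub_eq_iff_eq_add, Fin.coeSucc_eq_succ, eq_comm]
    have h2 : Fin.last D - 1 ≠ Fin.last D := by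
      have : NeZero D := ⟨by omega⟩
      rw [Ne, sub_eq_self]
      exact Fin.one_ne_zero_of_neZero
    simp only [h1, h2, if_false]
    simp only [Fin.lt_def, Fin.ext_iff, Fin.val_succ, Fin.val_last, Fin.val_zero]
    split_ifs <;> omega
  | cast i =>
    rw [Fin.coeSucc_eq_succ]
    simp only [cornerDoor, Pi.add_apply, alcoveStep, Equiv.subRight_apply]
    have h1 : i.castSucc - 1 = k.castSucc ↔ k.succ = i.castSucc := by
      rw [sub_eq_iff_eq_add, Fin.coeSucc_eq_succ, eq_comm]
    have h2 : i.castSucc - 1 = Fin.last D ↔ i.castSucc = 0 := by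
      rw [sub_eq_iff_eq_add, Fin.last_add_one]
    simp only [h1, h2]
    simp only [Fin.lt_def, Fin.ext_iff, Fin.val_succ, Fin.val_castSucc, Fin.val_zero]
    split_ifs <;> omega

theorem isDoor_cornerDoor {D : ℕ} {n : ℤ} (hn : 0 ≤ n) {L : (Fin D → ℤ) → Fin D × Bool}
    (hL : IsInwardLabelling n L) : IsDoor L (cornerDoor D) := by
  intro k
  refine ⟨k.succ, Fin.succ_ne_zero k, hL.lower _ _ ?_ fun l hl => ?_⟩
  · simp [cornerDoor]
  · simp [cornerDoor, hl, hn]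

theorem alcoveFlip_cornerDoor {D : ℕ} [NeZero D] :
    ∃ k, alcoveFlip (cornerDoor D) 0 k = -2 := by
  obtain ⟨d, rfl⟩ := Nat.exists_eq_succ_of_ne_zero (NeZero.ne D)
  refine ⟨Fin.last d, ?_⟩
  rw [alcoveFlip_zero]
  simp [cornerDoor, Fin.lt_def]

/-- A facet across which the alcove leaves the box lies in a face of the box, where labels are
dictated by the first coordinate outside `[0, n]`. An upper face cannot show the label `(k, true)`;
a lower face shows only labels up to `k`, so `k` is the last direction. The prescribed labels then
fix vertex `0` and the order of the steps. -/
theorem eq_cornerDoor {D : ℕ} [NeZero D] {n : ℤ} {L : (Fin D → ℤ) → Fin D × Bool}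
    (hL : IsInwardLabelling n L) {v : Fin (D + 1) → Fin D → ℤ} (hv : IsAlcove v)
    (hbox : ∀ i k, -1 ≤ v i k ∧ v i k ≤ n + 1) (hdoor : IsDoor L v)
    {k : Fin D} (hk : ¬ (-1 ≤ alcoveFlip v 0 k ∧ alcoveFlip v 0 k ≤ n + 1)) :
    v = cornerDoor D := by
  have label : ∀ i ≠ 0, ∀ k, ¬ (0 ≤ v i k ∧ v i k ≤ n) →
      ∃ l ≤ k, L (v i) = (l, true) ∧ v i l = -1 ∧ ∀ m < l, 0 ≤ v i m ∧ v i m ≤ n := by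
    intro i hi k hk
    obtain ⟨l, hl, hl', hm⟩ := exists_first_outside hk
    refine ⟨l, hl, ?_⟩
    have hb := hbox i l
    have hcases : v i l = -1 ∨ v i l = n + 1 := by omega
    rcases hcases with h | h
    · exact ⟨hL.lower _ _ h hm, h, hm⟩
    · have h2 := hdoor.snd_eq_true hi
      rw [hL.upper _ _ h hm] at h2
      exact absurd h2 (by simp)
  by_cases hlow : alcoveFlip v 0 k < -1
  swap
  · exfalso
    have hfac := lt_alcoveFlip hv (b := n + 1) (fun i => (hbox i k).2) (by omega)
    obtain ⟨i, hi, hLi⟩ := hdoor k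
    obtain ⟨l, hl, hLl, h1, hm⟩ := label i hi k (by have := hfac i hi; omega)
    have hlk : k = l := congrArg Prod.fst (hLi.symm.trans hLl)
    subst hlk
    have := hL.upper _ _ (hfac i hi) hm
    rw [hLi] at this
    exact absurd this (by simp)
  obtain ⟨p, hp⟩ := hv
  obtain ⟨hlast, hfac⟩ := alcoveFlip_lt hp (fun i => (hbox i k).1) hlow
  have hf := alcove_apply hp
  rw [hlast] at hf
  -- every label is at most `k`, so `k` is the last coordinate
  have hktop : ∀ l, l ≤ k := by
    intro l
    obtain ⟨i, hi, hLi⟩ := hdoor l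
    obtain ⟨m, hm, hLm, -⟩ := label i hi k (by have := hfac i hi; omega)
    have : l = m := congrArg Prod.fst (hLi.symm.trans hLm)
    exact this ▸ hm
  have hlab : ∀ l, ∃ i, i ≠ 0 ∧ v i l = -1 ∧ ∀ m < l, 0 ≤ v i m ∧ v i m ≤ n := by
    intro l
    obtain ⟨i, hi, hLi⟩ := hdoor l
    obtain ⟨m, hm, hLm, h⟩ := label i hi k (by have := hfac i hi; omega)
    have : l = m := congrArg Prod.fst (hLi.symm.trans hLm)
    exact ⟨i, hi, this ▸ h⟩
  have hpos : ∀ i : Fin (D + 1), i ≠ 0 → 0 < i := fun i hi => Fin.pos_of_ne_zero hi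
  have hne0 : ∀ l : Fin D, p.symm l.castSucc ≠ 0 := fun l h =>
    (Fin.castSucc_lt_last l).ne (p.symm.injective (h.trans hlast.symm))
  have hv0 : ∀ l, v 0 l = 0 := by
    intro l
    rcases (hktop l).lt_or_eq with hl | rfl
    · obtain ⟨i, hi, hi1, -⟩ := hlab l
      obtain ⟨j, hj, -, hj1⟩ := hlab k
      have e1 := hf i l
      have e2 := hf j l
      have e3 := hbox 0 l
      have e4 := hj1 l hl
      rw [if_pos (hpos i hi)] at e1
      rw [if_pos (hpos j hj)] at e2
      split_ifs at e1 e2 <;> omega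
    · have h1 := hf 1 l
      have hD := NeZero.pos D
      rw [if_pos (hpos 1 Fin.one_ne_zero_of_neZero), hfac 1 Fin.one_ne_zero_of_neZero,
        if_neg] at h1
      · omega
      · intro h
        have h := Fin.lt_def.1 h
        rw [Fin.val_one', Nat.mod_eq_of_lt (by omega)] at h
        exact hne0 l (Fin.ext (by simpa using h))
  -- At the vertex labelled `m`, coordinate `m` is still `-1` while every earlier coordinate `l` is
  -- back to at least `0`: step `e l` has been made, step `e m` has not.
  have hmono : StrictMono fun l : Fin D => p.symm l.castSucc := by
    intro l m hlm
    obtain ⟨i, hi, hi1, hi2⟩ := hlab m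
    have e1 := hf i m
    have e2 := hf i l
    have e3 := hi2 l hlm
    rw [if_pos (hpos i hi), hv0] at e1 e2
    change p.symm l.castSucc < p.symm m.castSucc
    refine lt_of_lt_of_le (b := i) ?_ ?_
    · by_contra h
      rw [if_neg h] at e2
      omega
    · by_contra h
      rw [if_pos (not_le.1 h)] at e1
      omega
  have hq : (fun l : Fin D => p.symm l.castSucc) = Fin.succ := by
    refine (hmono.range_inj Fin.strictMono_succ).1 ?_
    ext i
    rw [Fin.range_succ]
    constructor
    · rintro ⟨l, rfl⟩
      exact hne0 l
    · intro hi
      have : p i ≠ Fin.last D := fun h => hi (by rw [← hlast, ← h]; simp)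
      obtain ⟨l, hl⟩ := Fin.exists_castSucc_eq.2 this
      exact ⟨l, by simp [hl]⟩
  funext i l
  rw [hf, hv0, congrFun hq l, cornerDoor, zero_add]

/-- There is no inward pointing labelling of `[-1, n + 1] ^ D` without complementary labels at
neighbouring points. -/
theorem IsInwardLabelling.exists_complementary {D : ℕ} [NeZero D] {n : ℤ} (hn : 0 ≤ n)
    {L : (Fin D → ℤ) → Fin D × Bool} (hL : IsInwardLabelling n L) :
    ∃ x y : Fin D → ℤ, (∀ k, -1 ≤ x k ∧ x k ≤ n + 1) ∧ (∀ k, -1 ≤ y k ∧ y k ≤ n + 1) ∧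
      (∀ k, |x k - y k| ≤ 1) ∧ ∃ k, L x = (k, true) ∧ L y = (k, false) := by
  classical
  by_contra! hno
  let X : Set (Fin (D + 1) → Fin D → ℤ) :=
    {v | IsAlcove v ∧ (∀ i k, -1 ≤ v i k ∧ v i k ≤ n + 1) ∧ IsDoor L v}
  have hfin : X.Finite := by
    refine (Set.finite_Icc (fun _ _ => -1 : Fin (D + 1) → Fin D → ℤ)
      (fun _ _ => n + 1)).subset ?_
    rintro v ⟨-, h, -⟩
    exact ⟨fun i k => (h i k).1, fun i k => (h i k).2⟩
  -- The label of vertex `0` cannot be negative, since the door contains the complementary label at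
  -- a neighbouring point; so it repeats a label of the door.
  have hpartner : ∀ v ∈ X, ∃ j, j ≠ 0 ∧ L (v j) = L (v 0) := by
    rintro v ⟨hv, hbox, hdoor⟩
    obtain ⟨j, hj, hLj⟩ := hdoor (L (v 0)).1
    refine ⟨j, hj, ?_⟩
    rw [hLj]
    refine Prod.ext rfl ?_
    by_contra h
    have h' : (L (v 0)).2 = false := by simpa using Ne.symm h
    exact hno _ _ (hbox j) (hbox 0) (hv.abs_sub_le j 0) _ hLj (Prod.ext rfl h')
  choose! s hs0 hs using hpartner
  have hrot : ∀ v ∈ X, (fun i => v (i + s v)) ∈ X := by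
    rintro v hvX
    exact ⟨hvX.1.rotate _, fun i => hvX.2.1 _, hvX.2.2.rotate (hs0 v hvX) (hs v hvX)⟩
  have hcorner : cornerDoor D ∈ X := by
    refine ⟨isAlcove_cornerDoor D, fun i k => ?_, isDoor_cornerDoor hn hL⟩
    simp only [cornerDoor, Fin.lt_def, Fin.val_succ, Fin.val_zero]
    split_ifs <;> omega
  have heven : ∑ _v ∈ hfin.toFinset, (1 : ZMod 2) = 0 := by
    refine Finset.sum_involution (fun v _ => fun i => v (i + s v)) (fun _ _ => rfl)
      (fun v hv _ => ?_) (fun v hv => ?_) (fun v hv => ?_)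
    · exact (hfin.mem_toFinset.1 hv).1.rotate_ne (hs0 v (hfin.mem_toFinset.1 hv))
    · exact hfin.mem_toFinset.2 (hrot v (hfin.mem_toFinset.1 hv))
    · have hv := hfin.mem_toFinset.1 hv
      have hw := hrot v hv
      set w : Fin (D + 1) → Fin D → ℤ := fun i => v (i + s v) with hwdef
      -- Labels within a door are distinct, so the partner in the rotated alcove can only be the old
      -- vertex `0`.
      have hsw : s w = -s v := by
        refine hw.2.2.eq_of_label_eq (hs0 w hw) (neg_ne_zero.2 (hs0 v hv)) ?_
        rw [hs w hw]
        simp only [hwdef, zero_add, neg_add_cancel]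
        exact hs v hv
      funext i
      rw [hsw]
      exact congrArg v (neg_add_cancel_right i _)
  have heven' : ∑ _v ∈ hfin.toFinset.erase (cornerDoor D), (1 : ZMod 2) = 0 := by
    refine Finset.sum_involution (fun v _ => alcoveFlip v) (fun _ _ => rfl)
      (fun v hv _ => ?_) (fun v hv => ?_) (fun v hv => alcoveFlip_alcoveFlip v)
    · exact (hfin.mem_toFinset.1 (Finset.mem_of_mem_erase hv)).1.flip_ne
    · obtain ⟨hne, hv⟩ := Finset.mem_erase.1 hv
      obtain ⟨hv, hbox, hdoor⟩ := hfin.mem_toFinset.1 hv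
      refine Finset.mem_erase.2 ⟨?_, hfin.mem_toFinset.2 ⟨hv.flip, ?_, ?_⟩⟩
      · intro h
        obtain ⟨k, hk⟩ := alcoveFlip_cornerDoor (D := D)
        rw [← h, alcoveFlip_alcoveFlip] at hk
        have := hbox 0 k
        omega
      · intro i k
        by_cases hi : i = 0
        · subst hi
          by_contra h
          exact hne (eq_cornerDoor hL hv hbox hdoor h)
        · rw [alcoveFlip_apply_of_ne _ hi]
          exact hbox i k
      · intro k
        obtain ⟨i, hi, h⟩ := hdoor k
        exact ⟨i, hi, by rwa [alcoveFlip_apply_of_ne _ hi]⟩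
  rw [← Finset.add_sum_erase _ _ (hfin.mem_toFinset.2 hcorner), heven', add_zero] at heven
  exact one_ne_zero heven

/-! ### The Hex theorem. -/

/-- Neighbouring points of `[0, n] ^ D` of the same colour. -/
def ColourStep {D : ℕ} (n : ℤ) (c : (Fin D → ℤ) → Fin D) (x y : Fin D → ℤ) : Prop :=
  (∀ k, 0 ≤ x k ∧ x k ≤ n) ∧ (∀ k, 0 ≤ y k ∧ y k ≤ n) ∧ c x = c y ∧ ∀ k, |x k - y k| ≤ 1

theorem ColourStep.symm {D : ℕ} {n : ℤ} {c : (Fin D → ℤ) → Fin D} {x y : Fin D → ℤ}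
    (h : ColourStep n c x y) : ColourStep n c y x :=
  ⟨h.2.1, h.1, h.2.2.1.symm, fun k => by rw [abs_sub_comm]; exact h.2.2.2 k⟩

/-- The Hex theorem: if `[0, n] ^ D` is coloured with `D` colours, then for some `k` there is a
chain of colour `k` joining the two faces orthogonal to the `k`-th direction. -/
theorem exists_colour_chain {D : ℕ} [NeZero D] {n : ℤ} (hn : 0 ≤ n)
    (c : (Fin D → ℤ) → Fin D) :
    ∃ x y : Fin D → ℤ, (∀ k, 0 ≤ x k ∧ x k ≤ n) ∧ Relation.ReflTransGen (ColourStep n c) x y ∧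
      x (c x) = 0 ∧ y (c x) = n := by
  classical
  by_contra! hno
  -- `T x`: a chain of the colour of `x` reaches `x` from the lower face in that direction. Inside
  -- the box the label is the colour, signed by `T`. For complementary neighbours, either `T` would
  -- propagate along a colour step, or start on the lower face, or a chain would reach the upper
  -- face.
  let T : (Fin D → ℤ) → Prop := fun x => ∃ y, (∀ k, 0 ≤ y k ∧ y k ≤ n) ∧
    Relation.ReflTransGen (ColourStep n c) y x ∧ y (c y) = 0 ∧ c y = c x
  have hfirst : ∀ x : Fin D → ℤ, (∃ k, ¬ (0 ≤ x k ∧ x k ≤ n)) →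
      ∃ l, ¬ (0 ≤ x l ∧ x l ≤ n) ∧ ∀ m < l, 0 ≤ x m ∧ x m ≤ n := by
    rintro x ⟨k, hk⟩
    obtain ⟨l, -, h⟩ := exists_first_outside hk
    exact ⟨l, h⟩
  choose! f hf hf' using hfirst
  let L : (Fin D → ℤ) → Fin D × Bool := fun x =>
    if ∃ k, ¬ (0 ≤ x k ∧ x k ≤ n) then (f x, decide (x (f x) < 0)) else (c x, decide (T x))
  have hLout : ∀ x, (∃ k, ¬ (0 ≤ x k ∧ x k ≤ n)) → L x = (f x, decide (x (f x) < 0)) :=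
    fun x hx => if_pos hx
  have hLin : ∀ x, (¬ ∃ k, ¬ (0 ≤ x k ∧ x k ≤ n)) → L x = (c x, decide (T x)) :=
    fun x hx => if_neg hx
  have hfeq : ∀ x k, ¬ (0 ≤ x k ∧ x k ≤ n) → (∀ l < k, 0 ≤ x l ∧ x l ≤ n) → f x = k := by
    intro x k hk hlt
    rcases lt_trichotomy (f x) k with h | h | h
    · exact absurd (hlt _ h) (hf x ⟨k, hk⟩)
    · exact h
    · exact absurd (hf' x ⟨k, hk⟩ _ h) hk
  have hL : IsInwardLabelling n L := by
    constructor
    · intro x k hk hlt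
      have h : ¬ (0 ≤ x k ∧ x k ≤ n) := by omega
      rw [hLout x ⟨k, h⟩, hfeq x k h hlt, hk]
      rfl
    · intro x k hk hlt
      have h : ¬ (0 ≤ x k ∧ x k ≤ n) := by omega
      rw [hLout x ⟨k, h⟩, hfeq x k h hlt, hk]
      simp only [Prod.mk.injEq, true_and, decide_eq_false_iff_not]
      omega
  obtain ⟨x, y, hx, hy, hxy, k, hLx, hLy⟩ := hL.exists_complementary hn
  have hxyk := abs_le.1 (hxy k)
  have hxk := hx k
  have hyk := hy k
  by_cases hxo : ∃ k, ¬ (0 ≤ x k ∧ x k ≤ n)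
  · rw [hLout x hxo, Prod.mk.injEq, decide_eq_true_iff] at hLx
    obtain ⟨hfx, hx0⟩ := hLx
    rw [hfx] at hx0
    by_cases hyo : ∃ k, ¬ (0 ≤ y k ∧ y k ≤ n)
    · rw [hLout y hyo, Prod.mk.injEq, decide_eq_false_iff_not] at hLy
      have h1 := hf y hyo
      rw [hLy.1] at h1 hLy
      omega
    · rw [hLin y hyo, Prod.mk.injEq, decide_eq_false_iff_not] at hLy
      push Not at hyo
      have := hyo k
      refine hLy.2 ⟨y, hyo, .refl, ?_, rfl⟩
      rw [hLy.1]
      omega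
  · rw [hLin x hxo, Prod.mk.injEq, decide_eq_true_iff] at hLx
    push Not at hxo
    obtain ⟨hcx, z, hz, hzx, hz0, hcz⟩ := hLx
    by_cases hyo : ∃ k, ¬ (0 ≤ y k ∧ y k ≤ n)
    · rw [hLout y hyo, Prod.mk.injEq, decide_eq_false_iff_not] at hLy
      have h1 := hf y hyo
      rw [hLy.1] at h1 hLy
      have := hxo k
      refine hno z x hz hzx hz0 ?_
      rw [hcz, hcx]
      omega
    · rw [hLin y hyo, Prod.mk.injEq, decide_eq_false_iff_not] at hLy
      push Not at hyo
      exact hLy.2 ⟨z, hz, hzx.tail ⟨hxo, hyo, hcx.trans hLy.1.symm, hxy⟩, hz0,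
        hcz.trans (hcx.trans hLy.1.symm)⟩

/-! ### Arrows, powers of a set of arrows, and paths. -/

namespace ArrowGroupoid

section Algebra

variable {G : Type*} [ArrowGroupoid G]

theorem rng_of_mem_units {u : G} (hu : u ∈ units G) : rng u = u := by
  have hu : src u = u := hu
  rw [← hu, rng_src]

theorem rng_mem_units (g : G) : rng g ∈ units G := src_rng g

theorem comp_congr {g g' h h' : G} (hg : g = g') (hh : h = h') (e : src g = rng h) :
    comp g h e = comp g' h' (hg ▸ hh ▸ e) := by
  subst hg hh
  rfl

theorem comp_of_eq_rng {u h : G} (hu : u = rng h) (e : src u = rng h) : comp u h e = h := by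
  subst hu
  exact rng_comp_self h

theorem comp_of_eq_src {g u : G} (hu : u = src g) (e : src g = rng u) : comp g u e = g := by
  subst hu
  exact comp_src g

theorem inv_comp_cancel_left (g h : G) (e : src g = rng h) :
    comp (inv g) (comp g h e) ((src_inv g).trans (rng_comp g h e).symm) = h := by
  rw [← comp_assoc (inv g) g h (src_inv g) e]
  exact comp_of_eq_rng ((inv_comp g).trans e) _

theorem comp_inv_cancel_right (g h : G) (e : src g = rng h) :
    comp (comp g h e) (inv h) ((src_comp g h e).trans (rng_inv h).symm) = g := by
  rw [comp_assoc g h (inv h) e (rng_inv h).symm]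
  exact comp_of_eq_src ((comp_inv h).trans e.symm) _

theorem eq_inv_of_comp_eq {g h : G} (e : src g = rng h) (hc : comp g h e = rng g) :
    h = inv g := by
  rw [← inv_comp_cancel_left g h e]
  exact comp_of_eq_src (hc.trans (src_inv g).symm) _

theorem inv_inv_eq (g : G) : inv (inv g) = g :=
  (eq_inv_of_comp_eq (src_inv g) ((inv_comp g).trans (rng_inv g).symm)).symm

theorem inv_comp_rev (g h : G) (e : src g = rng h) :
    inv (comp g h e) = comp (inv h) (inv g) ((src_inv h).trans (e.symm.trans (rng_inv g).symm)) := by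
  refine (eq_inv_of_comp_eq ?_ ?_).symm
  · rw [src_comp, rng_comp, rng_inv]
  · exact (comp_assoc (comp g h e) (inv h) (inv g) ((src_comp g h e).trans (rng_inv h).symm)
      ((src_inv h).trans (e.symm.trans (rng_inv g).symm))).symm.trans
      ((comp_congr (comp_inv_cancel_right g h e) rfl _).trans
        ((comp_inv g).trans (rng_comp g h e).symm))

theorem inv_of_mem_units {u : G} (hu : u ∈ units G) : inv u = u := by
  refine (eq_inv_of_comp_eq (hu.trans (rng_of_mem_units hu).symm) ?_).symm
  rw [comp_of_eq_rng (rng_of_mem_units hu).symm, rng_of_mem_units hu]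

/-- The arrow `g h⁻¹` for arrows with a common source. -/
def quot (g h : G) (e : src g = src h) : G := comp g (inv h) (e.trans (rng_inv h).symm)

theorem src_quot (g h : G) (e : src g = src h) : src (quot g h e) = rng h := by
  rw [quot, src_comp, src_inv]

theorem rng_quot (g h : G) (e : src g = src h) : rng (quot g h e) = rng g := rng_comp _ _ _

theorem quot_self (g : G) : quot g g rfl = rng g := comp_inv g

theorem inv_quot (g h : G) (e : src g = src h) : inv (quot g h e) = quot h g e.symm := by
  rw [quot, inv_comp_rev, comp_congr (inv_inv_eq h) rfl, quot]

theorem quot_comp_quot (g h k : G) (e : src g = src h) (e' : src h = src k) :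
    comp (quot g h e) (quot h k e') ((src_quot g h e).trans (rng_quot h k e').symm) =
      quot g k (e.trans e') := by
  have h1 : src (quot g h e) = rng h := src_quot g h e
  have h2 : comp (quot g h e) h h1 = g := by
    have := comp_inv_cancel_right g (inv h) (e.trans (rng_inv h).symm)
    rwa [comp_congr rfl (inv_inv_eq h)] at this
  have h3 := comp_assoc (quot g h e) h (inv k) h1 (e'.trans (rng_inv k).symm)
  exact h3.symm.trans (comp_congr h2 rfl _)

theorem quot_left_injective {g g' h : G} {e : src g = src h} {e' : src g' = src h}
    (hq : quot g h e = quot g' h e') : g = g' := by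
  have key : ∀ (g : G) (e : src g = src h), comp (quot g h e) h (src_quot g h e) = g := by
    intro g e
    have := comp_inv_cancel_right g (inv h) (e.trans (rng_inv h).symm)
    rwa [comp_congr rfl (inv_inv_eq h)] at this
  rw [← key g e, ← key g' e']
  exact comp_congr hq rfl _

/-- Products of a unit with `n` elements of `L`. -/
def words (L : Set G) : ℕ → Set G
  | 0 => units G
  | n + 1 => {g | ∃ l ∈ L, ∃ h ∈ words L n, ∃ e : src l = rng h, g = comp l h e}

theorem words_mono {L : Set G} (hL : units G ⊆ L) : Monotone (words L) := by
  refine monotone_nat_of_le_succ fun n g hg => ?_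
  exact ⟨rng g, hL (rng_mem_units g), g, hg, src_rng g, (rng_comp_self g).symm⟩

theorem subset_words_one (L : Set G) : L ⊆ words L 1 := fun l hl =>
  ⟨l, hl, src l, src_src l, (rng_src l).symm, (comp_src l).symm⟩

theorem comp_mem_words {L : Set G} {m n : ℕ} {g h : G} (hg : g ∈ words L m) (hh : h ∈ words L n)
    (e : src g = rng h) : comp g h e ∈ words L (m + n) := by
  induction m generalizing g with
  | zero =>
    have hg : g ∈ units G := hg
    rw [Nat.zero_add, comp_of_eq_rng (hg.symm.trans e)]
    exact hh
  | succ m ih =>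
    obtain ⟨l, hl, g, hg, e', rfl⟩ := hg
    have e1 : src g = rng h := (src_comp l g e').symm.trans e
    rw [comp_assoc l g h e' e1, Nat.succ_add]
    exact ⟨l, hl, _, ih hg e1, _, rfl⟩

theorem inv_mem_words {L : Set G} (hL : ∀ l ∈ L, inv l ∈ L) {n : ℕ} {g : G}
    (hg : g ∈ words L n) : inv g ∈ words L n := by
  induction n generalizing g with
  | zero =>
    have hg : g ∈ units G := hg
    rw [inv_of_mem_units hg]
    exact hg
  | succ n ih =>
    obtain ⟨l, hl, g, hg, e, rfl⟩ := hg
    rw [inv_comp_rev]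
    exact comp_mem_words (ih hg) (subset_words_one L (hL l hl)) _

theorem words_subset_of_succ_subset {L : Set G} (hL : units G ⊆ L) {n : ℕ}
    (hn : words L (n + 1) ⊆ words L n) (m : ℕ) : words L m ⊆ words L n := by
  induction m with
  | zero => exact words_mono hL (Nat.zero_le n)
  | succ m ih =>
    rintro _ ⟨l, hl, g, hg, e, rfl⟩
    exact hn ⟨l, hl, g, ih hg, e, rfl⟩

theorem isSubgroupoid_words {L : Set G} (hLu : units G ⊆ L) (hL : ∀ l ∈ L, inv l ∈ L) {n : ℕ}
    (hn : words L (n + 1) ⊆ words L n) : IsSubgroupoid (words L n) := by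
  exact ⟨fun g hg => inv_mem_words hL hg,
    fun g hg h hh e => words_subset_of_succ_subset hLu hn _ (comp_mem_words hg hh e)⟩

/-- `γ j` is the product of the last `j` factors; past `n` the path stands still, using units as
steps. -/
theorem exists_path_of_mem_words {L : Set G} (hL : units G ⊆ L) {n : ℕ} {g : G}
    (hg : g ∈ words L n) : ∃ γ : ℕ → G, γ 0 ∈ units G ∧ γ n = g ∧
      ∀ j, ∃ l ∈ L, ∃ e : src l = rng (γ j), γ (j + 1) = comp l (γ j) e := by
  induction n generalizing g with
  | zero =>
    have hg' : g ∈ units G := hg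
    refine ⟨fun _ => g, hg, rfl, fun _ => ⟨rng g, hL (rng_mem_units g), src_rng g,
      (rng_comp_self g).symm⟩⟩
  | succ n ih =>
    obtain ⟨l, hl, g', hg', e, rfl⟩ := hg
    obtain ⟨γ, h0, hn, hstep⟩ := ih hg'
    refine ⟨fun j => if j ≤ n then γ j else comp l g' e, by simpa using h0, by simp,
      fun j => ?_⟩
    rcases lt_trichotomy j n with h | rfl | h
    · simpa only [if_pos h.le, if_pos (Nat.succ_le_of_lt h)] using hstep j
    · subst hn
      exact ⟨l, hl, by simpa using e, by simp⟩
    · simp only [if_neg h.not_ge, if_neg (h.trans j.lt_succ_self).not_ge]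
      exact ⟨_, hL (rng_mem_units _), src_rng _, (rng_comp_self _).symm⟩

/-- If the powers of `L` do not stabilise, then some orbit contains arbitrarily long injective
paths with steps in `L`; here `a i j` is the arrow from the `j`-th to the `i`-th point. -/
theorem exists_injective_arrows {L : Set G} (hL : units G ⊆ L) (hinv : ∀ l ∈ L, inv l ∈ L) {n : ℕ}
    (hn : ¬ words L (n + 1) ⊆ words L n) :
    ∃ a : ℕ → ℕ → G, (∀ i j, src (a i j) = a j j) ∧ (∀ i j, rng (a i j) = a i i) ∧
      (∀ i j k (e : src (a i j) = rng (a j k)), comp (a i j) (a j k) e = a i k) ∧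
      (∀ i j, i ≤ j + 1 → j ≤ i + 1 → a i j ∈ L) ∧
      ∀ j, Set.InjOn (fun i => a i j) (Set.Iic n) := by
  obtain ⟨g, hg, hgn⟩ := Set.not_subset.1 hn
  obtain ⟨γ, h0, rfl, hstep⟩ := exists_path_of_mem_words hL hg
  have hwalk : ∀ i j t, γ j ∈ words L i → γ (j + t) ∈ words L (i + t) := by
    intro i j t h
    induction t with
    | zero => exact h
    | succ t ih =>
      obtain ⟨l, hl, e, h⟩ := hstep (j + t)
      exact ⟨l, hl, _, ih, e, h⟩
  have hword : ∀ i, γ i ∈ words L i := fun i => by simpa using hwalk 0 0 i h0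
  -- A repetition could be cut out of the path, writing `g` with at most `n` factors.
  have hinj : ∀ i j, i < j → j ≤ n → γ i ≠ γ j := by
    intro i j hij hj h
    have h1 := hwalk i j (n + 1 - j) (h ▸ hword i)
    rw [show j + (n + 1 - j) = n + 1 by omega] at h1
    exact hgn (words_mono hL (by omega) h1)
  have hsrc : ∀ i, src (γ i) = src (γ 0) := by
    intro i
    induction i with
    | zero => rfl
    | succ i ih =>
      obtain ⟨l, hl, e, h⟩ := hstep i
      rw [h, src_comp, ih]
  have hs : ∀ i j, src (γ i) = src (γ j) := fun i j => (hsrc i).trans (hsrc j).symm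
  have hself : ∀ i, quot (γ i) (γ i) (hs i i) = rng (γ i) := fun i => quot_self _
  have hsucc : ∀ i, quot (γ (i + 1)) (γ i) (hs _ _) ∈ L := by
    intro i
    obtain ⟨l, hl, e, h⟩ := hstep i
    have h1 : quot (γ (i + 1)) (γ i) (hs _ _) = l :=
      (comp_congr h rfl _).trans (comp_inv_cancel_right l (γ i) e)
    rwa [h1]
  refine ⟨fun i j => quot (γ i) (γ j) (hs i j), fun i j => ?_, fun i j => ?_, fun i j k e => ?_,
    fun i j hij hji => ?_, fun j => ?_⟩
  · exact (src_quot _ _ _).trans (hself j).symm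
  · exact (rng_quot _ _ _).trans (hself i).symm
  · exact quot_comp_quot _ _ _ _ _
  · rcases lt_trichotomy i j with h | rfl | h
    · obtain rfl : j = i + 1 := by omega
      change quot _ _ _ ∈ L
      rw [← inv_quot (γ (i + 1)) (γ i) (hs _ _)]
      exact hinv _ (hsucc i)
    · change quot _ _ _ ∈ L
      rw [hself]
      exact hL (rng_mem_units _)
    · obtain rfl : i = j + 1 := by omega
      exact hsucc j
  · intro i hi i' hi' h
    have h : γ i = γ i' := quot_left_injective h
    rcases lt_trichotomy i i' with h1 | h1 | h1
    · exact absurd h (hinj _ _ h1 hi')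
    · exact h1
    · exact absurd h.symm (hinj _ _ h1 hi)

end Algebra

/-! ### Compactness and counting in étale groupoids. -/

section Topology

variable {G : Type*} [TopologicalSpace G] [ArrowGroupoid G]

theorem IsEtale.continuous_src (hG : IsEtale G) : Continuous (src : G → G) :=
  continuous_subtype_val.comp hG.1.continuous

theorem IsEtale.continuous_rng (hG : IsEtale G) : Continuous (rng : G → G) :=
  continuous_subtype_val.comp hG.2.continuous

theorem IsEtale.exists_isOpen_injOn (hG : IsEtale G) (g : G) :
    ∃ V : Set G, IsOpen V ∧ g ∈ V ∧ Set.InjOn src V := by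
  obtain ⟨e, hge, he⟩ := hG.1 g
  refine ⟨e.source, e.open_source, hge, fun x hx y hy hxy => e.injOn hx hy ?_⟩
  rw [← he]
  exact Subtype.ext hxy

theorem IsEtale.isOpen_units (hG : IsEtale G) : IsOpen (units G) := by
  rw [isOpen_iff_forall_mem_open]
  intro u hu
  obtain ⟨V, hV, huV, hinj⟩ := hG.exists_isOpen_injOn u
  refine ⟨V ∩ src ⁻¹' V, fun g hg => hinj hg.2 hg.1 (src_src g),
    hV.inter (hV.preimage hG.continuous_src), huV, ?_⟩
  have hu : src u = u := hu
  rwa [Set.mem_preimage, hu]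

/-- Finitely many open sets on which `src` is injective cover `C`, and each contains at most one
point of a source fibre. -/
theorem IsEtale.exists_card_fiber_le (hG : IsEtale G) {C : Set G} (hC : IsCompact C) :
    ∃ N : ℕ, ∀ (F : Finset G) (u : G), (∀ g ∈ F, g ∈ C ∧ src g = u) → F.card ≤ N := by
  choose V hV hmem hinj using hG.exists_isOpen_injOn
  obtain ⟨t, -, ht⟩ := hC.elim_nhds_subcover V fun g _ => (hV g).mem_nhds (hmem g)
  refine ⟨t.card, fun F u hF => ?_⟩
  have h : ∀ g ∈ F, ∃ x ∈ t, g ∈ V x := fun g hg => by simpa using ht (hF g hg).1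
  choose! f hft hfV using h
  refine Finset.card_le_card_of_injOn f hft fun g hg g' hg' hgg' => ?_
  exact hinj (f g) (hfV g hg) (hgg' ▸ hfV g' hg') ((hF g hg).2.trans (hF g' hg').2.symm)

theorem exists_isCompact_words_subset [IsTopologicalGroupoid G] [T2Space G] (hG : IsEtale G)
    [CompactSpace (units G)] {L : Set G} (hL : IsRelativelyCompact L) (n : ℕ) :
    ∃ C, IsCompact C ∧ words L n ⊆ C := by
  induction n with
  | zero => exact ⟨units G, isCompact_iff_compactSpace.2 inferInstance, subset_rfl⟩
  | succ n ih =>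
    obtain ⟨C, hC, hsub⟩ := ih
    have hclosed : IsClosed {p : G × G | src p.1 = rng p.2} :=
      isClosed_eq (hG.continuous_src.comp continuous_fst) (hG.continuous_rng.comp continuous_snd)
    have hcomp : IsCompact (((↑) : {p : G × G // src p.1 = rng p.2} → G × G) ⁻¹'
        (closure L ×ˢ C)) :=
      hclosed.isClosedEmbedding_subtypeVal.isCompact_preimage (hL.prod hC)
    refine ⟨_, hcomp.image IsTopologicalGroupoid.continuous_comp, ?_⟩
    rintro _ ⟨l, hl, g, hg, e, rfl⟩
    exact ⟨⟨(l, g), e⟩, ⟨subset_closure hl, hsub hg⟩, rfl⟩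

/-- If `G` does not have dynamic asymptotic dimension zero, then its orbits contain arbitrarily
long injective paths with steps in a fixed relatively compact open set. -/
theorem IsEtale.exists_arrows [IsTopologicalGroupoid G] [T2Space G] (hG : IsEtale G)
    [CompactSpace (units G)] (hdad : ¬ HasDadProperty G 0) :
    ∃ L : Set G, IsOpen L ∧ IsRelativelyCompact L ∧ units G ⊆ L ∧ ∀ n : ℕ,
      ∃ a : ℕ → ℕ → G, (∀ i j, src (a i j) = a j j) ∧ (∀ i j, rng (a i j) = a i i) ∧
      (∀ i j k (e : src (a i j) = rng (a j k)), comp (a i j) (a j k) e = a i k) ∧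
      (∀ i j, i ≤ j + 1 → j ≤ i + 1 → a i j ∈ L) ∧
      ∀ j, Set.InjOn (fun i => a i j) (Set.Iic n) := by
  unfold HasDadProperty at hdad
  push Not at hdad
  obtain ⟨K, hKo, hKc, hK⟩ := hdad
  -- For `d = 0` the whole unit space is an admissible cover.
  have hK : ∀ H : Set G, IsSubgroupoid H → IsRelativelyCompact H → ¬ K ⊆ H := by
    intro H hH hHc hKH
    obtain ⟨i, hi⟩ := hK (fun _ => Set.univ) (fun _ => isOpen_univ)
      (fun _ _ => Set.mem_iUnion.2 ⟨0, trivial⟩)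
    exact hi H hH hHc fun g hg => hKH hg.1
  have hci : Continuous (inv : G → G) := IsTopologicalGroupoid.continuous_inv
  let L : Set G := K ∪ inv ⁻¹' K ∪ units G
  have hinv : ∀ l ∈ L, inv l ∈ L := by
    rintro l ((hl | hl) | hl)
    · refine Or.inl (Or.inr ?_)
      rwa [Set.mem_preimage, inv_inv_eq]
    · exact Or.inl (Or.inl hl)
    · refine Or.inr ?_
      rwa [inv_of_mem_units hl]
  have hLc : IsRelativelyCompact L := by
    refine IsCompact.closure_of_subset ((hKc.union (hKc.image hci)).union
      (isCompact_iff_compactSpace.2 (inferInstance : CompactSpace (units G)))) ?_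
    refine Set.union_subset_union_left _ (Set.union_subset_union subset_closure ?_)
    intro g hg
    exact ⟨inv g, subset_closure hg, inv_inv_eq g⟩
  have hLu : units G ⊆ L := Set.subset_union_right
  refine ⟨L, (hKo.union (hKo.preimage hci)).union hG.isOpen_units, hLc, hLu, fun n => ?_⟩
  refine exists_injective_arrows hLu hinv (n := n) fun hn => ?_
  obtain ⟨C, hC, hsub⟩ := exists_isCompact_words_subset hG hLc (n + 1)
  refine hK (words L n) (isSubgroupoid_words hLu hinv hn)
    (hC.closure_of_subset ((words_mono hLu n.le_succ).trans hsub)) ?_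
  exact fun g hg => words_subset_of_succ_subset hLu hn 1
    (subset_words_one L (Or.inl (Or.inl hg) : g ∈ L))

theorem not_hasDadProperty_zero (h : 1 ≤ dad G) : ¬ HasDadProperty G 0 := by
  intro h0
  have : dad G ≤ ((0 : ℕ) : ℕ∞) := iInf₂_le 0 h0
  have h2 := h.trans this
  simp at h2

end Topology

/-! ### Boxes in the infinite product. -/

section Product

variable {G : ℕ → Type*} [∀ i, TopologicalSpace (G i)] [∀ i, ArrowGroupoid (G i)]

theorem isOpen_productBox (hu : ∀ i, IsOpen (units (G i))) {L : ∀ i, Set (G i)}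
    (hL : ∀ i, IsOpen (L i)) (d : ℕ) :
    IsOpen {z : InfiniteProduct G | (∀ i ≤ d, z i ∈ L i) ∧ ∀ i, d < i → z i ∈ units (G i)} := by
  refine IsOpen.and ?_ ?_
  · have h : {z : InfiniteProduct G | ∀ i ≤ d, z i ∈ L i} =
        ⋂ i ∈ Set.Iic d, {z : InfiniteProduct G | z i ∈ L i} := by
      ext z
      simp
    change IsOpen {z : InfiniteProduct G | ∀ i ≤ d, z i ∈ L i}
    rw [h]
    exact (Set.finite_Iic d).isOpen_biInter fun i _ =>
      (hL i).preimage (RestrictedProduct.continuous_eval i)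
  · exact RestrictedProduct.isOpen_forall_imp_mem hu

/-- By Tychonoff: with the exceptional coordinates confined to `i ≤ d`, the topology is that of the
full product, and the box lies in the continuous image of a product of compact sets. -/
theorem isRelativelyCompact_productBox [∀ i, T2Space (G i)] [∀ i, CompactSpace (units (G i))]
    {L : ∀ i, Set (G i)} (hL : ∀ i, IsRelativelyCompact (L i)) (d : ℕ) :
    IsRelativelyCompact
      {z : InfiniteProduct G | (∀ i ≤ d, z i ∈ L i) ∧ ∀ i, d < i → z i ∈ units (G i)} := by
  classical
  let S : Set ℕ := Set.Ioi d
  have hS : cofinite ≤ 𝓟 S := by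
    rw [le_principal_iff, Nat.cofinite_eq_atTop]
    exact Ioi_mem_atTop d
  let C : ∀ i, Set (G i) := fun i => if i ≤ d then closure (L i) else units (G i)
  have hC : ∀ i, IsCompact (C i) := by
    intro i
    by_cases h : i ≤ d
    · simp only [C, if_pos h]
      exact hL i
    · simp only [C, if_neg h]
      exact isCompact_iff_compactSpace.2 inferInstance
  let W : Set (Πʳ i, [G i, units (G i)]_[𝓟 S]) := {z | ∀ i, z i ∈ C i}
  have hW : IsCompact W := by
    rw [RestrictedProduct.isEmbedding_coe_of_principal.isCompact_iff]
    convert isCompact_univ_pi hC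
    ext z
    constructor
    · rintro ⟨z, hz, rfl⟩ i -
      exact hz i
    · intro hz
      refine ⟨⟨z, eventually_principal.2 fun i hi => ?_⟩, fun i => hz i trivial, rfl⟩
      have := hz i trivial
      simpa only [C, if_neg (not_le.2 (Set.mem_Ioi.1 hi))] using this
  refine (hW.image (RestrictedProduct.continuous_inclusion hS)).closure_of_subset ?_
  rintro z ⟨hz, hz'⟩
  refine ⟨⟨fun i => z i, eventually_principal.2 fun i hi => hz' i hi⟩, fun i => ?_, rfl⟩
  change z i ∈ C i
  by_cases h : i ≤ d
  · simp only [C, if_pos h]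
    exact subset_closure (hz i h)
  · simp only [C, if_neg h]
    exact hz' i (not_le.1 h)

end Product

end ArrowGroupoid

/-! ### The coloured grid and the contradiction. -/

/-- A discrete intermediate value theorem: a colour step moves each coordinate by at most one. -/
theorem exists_reachable_of_le {D : ℕ} {n : ℤ} {c : (Fin D → ℤ) → Fin D} {x y : Fin D → ℤ}
    (hxy : Relation.ReflTransGen (ColourStep n c) x y) (k : Fin D) {j : ℤ} (hj : x k ≤ j)
    (hjy : j ≤ y k) : ∃ z, Relation.ReflTransGen (ColourStep n c) x z ∧ z k = j := by
  induction hxy with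
  | refl => exact ⟨x, .refl, le_antisymm hj hjy⟩
  | tail h1 h2 ih =>
    rename_i y z
    by_cases h : j ≤ y k
    · exact ih h
    · have := abs_le.1 (h2.2.2.2 k)
      exact ⟨z, h1.tail h2, by omega⟩

namespace ArrowGroupoid

theorem not_hasDadProperty_infiniteProduct {G : ℕ → Type*} [∀ i, TopologicalSpace (G i)]
    [∀ i, ArrowGroupoid (G i)] [∀ i, IsTopologicalGroupoid (G i)] [∀ i, T2Space (G i)]
    (hG : ∀ i, IsEtale (G i)) [∀ i, CompactSpace (units (G i))]
    (hdad : ∀ i, ¬ HasDadProperty (G i) 0) (d : ℕ) :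
    ¬ HasDadProperty (InfiniteProduct G) d := by
  intro hd
  choose L hLo hLc hLu hL using fun i => (hG i).exists_arrows (hdad i)
  obtain ⟨U, -, hcover, hU⟩ := hd _ (isOpen_productBox (fun i => (hG i).isOpen_units) hLo d)
    (isRelativelyCompact_productBox hLc d)
  choose H hH hHc hKH using hU
  have hcard : ∀ k : Fin (d + 1), ∃ N : ℕ, ∀ (F : Finset (G k)) (u : G k),
      (∀ g ∈ F, g ∈ (fun z : InfiniteProduct G => z k) '' closure (H k) ∧ src g = u) →
        F.card ≤ N := fun k =>
    (hG k).exists_card_fiber_le ((hHc k).image (RestrictedProduct.continuous_eval (k : ℕ)))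
  choose N hN using hcard
  -- Any `n` bounding every `N k` would do. The bounds depend only on the subgroupoids `H k`, so the
  -- paths may be chosen after them.
  let n : ℕ := ∑ k, N k
  choose a hsrc hrng hcomp haL hinj using fun i => hL i n
  have hunit : ∀ i j, a i j j ∈ units (G i) := fun i j => hsrc i j j
  let ext : (Fin (d + 1) → ℤ) → ℕ → ℕ := fun x i =>
    if h : i < d + 1 then (x ⟨i, h⟩).toNat else 0
  have hext : ∀ x (k : Fin (d + 1)), ext x k = (x k).toNat := fun x k => dif_pos k.2
  have hext0 : ∀ x i, d < i → ext x i = 0 := fun x i hi => dif_neg (by omega)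
  -- The arrow from grid point `y` to grid point `x`; beyond factor `d` it is the unit at the start
  -- of the chosen path.
  let A : (Fin (d + 1) → ℤ) → (Fin (d + 1) → ℤ) → InfiniteProduct G := fun x y =>
    ⟨fun i => a i (ext x i) (ext y i), by
      rw [Nat.cofinite_eq_atTop]
      filter_upwards [eventually_gt_atTop d] with i hi
      rw [hext0 x i hi, hext0 y i hi]
      exact hunit i 0⟩
  have hAsrc : ∀ x y, src (A x y) = A y y := fun x y =>
    RestrictedProduct.ext _ _ fun i => hsrc i _ _
  have hArng : ∀ x y, rng (A x y) = A x x := fun x y =>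
    RestrictedProduct.ext _ _ fun i => hrng i _ _
  have hAcomp : ∀ x y z (e : src (A x y) = rng (A y z)), comp (A x y) (A y z) e = A x z :=
    fun x y z e => RestrictedProduct.ext _ _ fun i => hcomp i _ _ _ _
  have hAK : ∀ x y, (∀ k, |x k - y k| ≤ 1) → A x y ∈
      {z : InfiniteProduct G | (∀ i ≤ d, z i ∈ L i) ∧ ∀ i, d < i → z i ∈ units (G i)} := by
    intro x y hxy
    refine ⟨fun i hi => haL i _ _ ?_ ?_, fun i hi => ?_⟩
    · have := abs_le.1 (hxy ⟨i, by omega⟩)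
      simp only [ext, dif_pos (show i < d + 1 by omega)]
      omega
    · have := abs_le.1 (hxy ⟨i, by omega⟩)
      simp only [ext, dif_pos (show i < d + 1 by omega)]
      omega
    · change a i (ext x i) (ext y i) ∈ units (G i)
      rw [hext0 x i hi, hext0 y i hi]
      exact hunit i 0
  have hAself : ∀ x, ∃ k, srcMap (A x x) ∈ U k := fun x =>
    Set.mem_iUnion.1 (hcover (Or.inl ⟨A x x, hAK x x (by simp), rfl⟩))
  choose c hc using hAself
  have hstep : ∀ x y, (∀ k, |x k - y k| ≤ 1) → c x = c y → A x y ∈ H (c y) := by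
    intro x y hxy hcxy
    have h1 : srcMap (A x y) = srcMap (A y y) :=
      Subtype.ext ((hAsrc x y).trans (hAsrc y y).symm)
    have h2 : rngMap (A x y) = srcMap (A x x) :=
      Subtype.ext ((hArng x y).trans (hAsrc x x).symm)
    refine hKH (c y) ⟨hAK x y hxy, ?_, ?_⟩
    · rw [h1]
      exact hc y
    · rw [h2, ← hcxy]
      exact hc x
  obtain ⟨x, y, -, hxy, hx0, hyn⟩ := exists_colour_chain (n := n) (Int.natCast_nonneg n) c
  -- Composing the steps along the chain stays in `H (c x)`, because it is a subgroupoid.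
  have hreach : ∀ z, Relation.ReflTransGen (ColourStep n c) x z →
      c z = c x ∧ A z x ∈ H (c x) := by
    intro z hz
    induction hz with
    | refl => exact ⟨rfl, hstep x x (by simp) rfl⟩
    | tail _ h ih =>
      rename_i w z _
      refine ⟨h.2.2.1.symm.trans ih.1, ?_⟩
      have h1 := hstep z w h.symm.2.2.2 h.2.2.1.symm
      rw [ih.1] at h1
      have e : src (A z w) = rng (A w x) := (hAsrc z w).trans (hArng w x).symm
      have h2 := (hH (c x)).comp_mem _ h1 _ ih.2 e
      rwa [hAcomp] at h2
  classical
  -- Since `x (c x) = 0`, the arrows `A z x` project to `a (c x) j 0` with `j = z (c x)`, and `j`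
  -- takes all the `n + 1` values from `0` to `n` along the chain.
  have hle := hN (c x) ((Finset.range (n + 1)).image fun j => a (c x) j 0) (a (c x) 0 0) ?_
  · rw [Finset.card_image_of_injOn, Finset.card_range] at hle
    · have : N (c x) ≤ n := Finset.single_le_sum (fun _ _ => Nat.zero_le _) (Finset.mem_univ _)
      omega
    · intro i hi j hj hij
      refine hinj (c x) 0 ?_ ?_ hij
      · exact Nat.lt_succ_iff.1 (by simpa using hi)
      · exact Nat.lt_succ_iff.1 (by simpa using hj)
  · intro g hg
    obtain ⟨j, hj, rfl⟩ := Finset.mem_image.1 hg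
    refine ⟨?_, hsrc _ _ _⟩
    have hj : j < n + 1 := Finset.mem_range.1 hj
    obtain ⟨z, hz, hzj⟩ := exists_reachable_of_le hxy (c x) (j := j) (by omega) (by omega)
    refine ⟨A z x, subset_closure (hreach z hz).2, ?_⟩
    change a (c x) (ext z (c x)) (ext x (c x)) = _
    rw [hext, hext, hzj, hx0]
    rfl

end ArrowGroupoid

theorem corollary3p2 (G : ℕ → Type*) [∀ i, TopologicalSpace (G i)] [∀ i, ArrowGroupoid (G i)]
    [∀ i, ArrowGroupoid.IsTopologicalGroupoid (G i)]
    [∀ i, SecondCountableTopology (G i)] [∀ i, LocallyCompactSpace (G i)] [∀ i, T2Space (G i)]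
    (hprincipal : ∀ i, ArrowGroupoid.IsPrincipal (G i))
    (hetale : ∀ i, ArrowGroupoid.IsEtale (G i))
    (hcompact : ∀ i, CompactSpace (ArrowGroupoid.units (G i)))
    (hzero : ∀ i, TopologicalSpace.IsTopologicalBasis
      {s : Set (ArrowGroupoid.units (G i)) | IsClopen s})
    (hdad : ∀ i, 1 ≤ ArrowGroupoid.dad (G i)) :
    ArrowGroupoid.dad (ArrowGroupoid.InfiniteProduct G) = ⊤ := by
  refine iInf₂_eq_top.2 fun d hd => ?_
  exact absurd hd (ArrowGroupoid.not_hasDadProperty_infiniteProduct hetale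
    (fun i => ArrowGroupoid.not_hasDadProperty_zero (hdad i)) d)
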